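/- Let $X \neq \{0\}$ be a Banach space over $\mathbb{K} \in \{\mathbb{R}, \mathbb{C}\}$, with unit sphere $S_X$, dual $X^*$, and space $\mathcal{L}(X)$ of bounded linear operators on $X$ with the operator norm. Put $\Pi(X) = \{(x,x^*) \in S_X \times S_{X^*} : x^*(x) = 1\}$ and, for $T \in \mathcal{L}(X)$, let $v(T) = \sup\{|x^*(T(x))| : (x,x^*) \in \Pi(X)\}$ be its numerical radius. Let $\mathcal{Z}(X) = \{T \in \mathcal{L}(X) : v(T) = 0\}$, let $\|T + \mathcal{Z}(X)\| = \inf\{\|T - S\| : S \in \mathcal{Z}(X)\}$, and let $$n'(X) = \max\{k \geq 0 : k\,\|T + \mathcal{Z}(X)\| \leq v(T) \text{ for all } T \in \mathcal{L}(X)\}$$ be the second numerical index of $X$. Let $G$ be the group of surjective linear isometries of $X$ with the topology of the operator norm. Suppose that the norm of $X$ is micro-transitive, that is, for every neighbourhood $U$ of the identity in $G$ and every $x \in S_X$, the set $\{g(x) : g \in U\}$ is a neighbourhood of $x$ in $S_X$. Suppose also that $n'(X) > 0$. Then $X$ has the Bishop–Phelps–Bollobás point property for numerical radius (BPBpp-nu):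 for every $\varepsilon > 0$ there is $\eta(\varepsilon) > 0$ such that, whenever $T \in \mathcal{L}(X)$ with $v(T) = 1$ and $(x,x^*) \in \Pi(X)$ satisfy $|x^*(T(x))| > 1 - \eta(\varepsilon)$, there exists $S \in \mathcal{L}(X)$ with $v(S) = 1$, $|x^*(S(x))| = 1$ and $\|S - T\| < \varepsilon$. -/

import Mathlib

open Set Metric Topology

noncomputable section

namespace NumRadius

variable (𝕜 : Type*) [RCLike 𝕜] (X : Type*) [NormedAddCommGroup X] [NormedSpace 𝕜 X]

/-- The set `Π(X)` of states of `X`. -/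
def states : Set (X × StrongDual 𝕜 X) :=
  {p | p.1 ∈ sphere (0 : X) 1 ∧ p.2 ∈ sphere (0 : StrongDual 𝕜 X) 1 ∧ p.2 p.1 = 1}

variable {𝕜 X}

/-- The numerical radius `v(T) = sup {|x*(T x)| : (x, x*) ∈ Π(X)}`. -/
def numericalRadius (T : X →L[𝕜] X) : ℝ :=
  ⨆ p : states 𝕜 X, ‖p.1.2 (T p.1.1)‖

theorem norm_apply_le_norm (T : X →L[𝕜] X) (p : states 𝕜 X) : ‖p.1.2 (T p.1.1)‖ ≤ ‖T‖ := by
  obtain ⟨⟨x, f⟩, hx, hf, -⟩ := p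
  rw [mem_sphere_zero_iff_norm] at hx hf
  calc ‖f (T x)‖ ≤ ‖f‖ * ‖T x‖ := f.le_opNorm _
    _ = ‖T x‖ := by rw [hf, one_mul]
    _ ≤ ‖T‖ * ‖x‖ := T.le_opNorm _
    _ = ‖T‖ := by rw [hx, mul_one]

theorem bddAbove_range_state (T : X →L[𝕜] X) :
    BddAbove (range fun p : states 𝕜 X => ‖p.1.2 (T p.1.1)‖) :=
  ⟨‖T‖, by rintro _ ⟨p, rfl⟩; exact norm_apply_le_norm T p⟩

theorem numericalRadius_nonneg (T : X →L[𝕜] X) : 0 ≤ numericalRadius T :=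
  Real.iSup_nonneg fun _ => norm_nonneg _

theorem numericalRadius_eq_zero_iff (T : X →L[𝕜] X) :
    numericalRadius T = 0 ↔ ∀ p ∈ states 𝕜 X, p.2 (T p.1) = 0 := by
  constructor
  · intro h p hp
    have := le_ciSup (bddAbove_range_state T) ⟨p, hp⟩
    exact norm_le_zero_iff.1 (this.trans h.le)
  · intro h
    refine le_antisymm (Real.iSup_le (fun p => ?_) le_rfl) (numericalRadius_nonneg T)
    rw [h p.1 p.2, norm_zero]

variable (𝕜 X)

/-- The subspace `Z(X)` of skew-hermitian operators, i.e. the operators of numerical radius `0`. -/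
def skewHermitian : Submodule 𝕜 (X →L[𝕜] X) where
  carrier := {T | numericalRadius T = 0}
  zero_mem' := (numericalRadius_eq_zero_iff _).2 fun p _ => by simp
  add_mem' {S T} hS hT := (numericalRadius_eq_zero_iff _).2 fun p hp => by
    simp [(numericalRadius_eq_zero_iff S).1 hS p hp, (numericalRadius_eq_zero_iff T).1 hT p hp]
  smul_mem' c T hT := (numericalRadius_eq_zero_iff _).2 fun p hp => by
    simp [(numericalRadius_eq_zero_iff T).1 hT p hp]

/-- The second numerical index `n'(X)`, the largest `k ≥ 0` such that
`k * ‖T + Z(X)‖ ≤ v(T)` for every operator `T`, where `‖T + Z(X)‖` is the quotient norm,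
`inf {‖T - S‖ : S ∈ Z(X)}`. For `X = {0}` there is no largest such `k`, and the value here
is `0`. -/
def secondNumericalIndex : ℝ :=
  sSup {k : ℝ | 0 ≤ k ∧ ∀ T : X →L[𝕜] X,
    k * ‖(skewHermitian 𝕜 X).mkQ T‖ ≤ numericalRadius T}

/-- An action of a topological group `G` on a topological space `T` is micro-transitive if
for every neighbourhood `U` of the identity and every point `t`, the set `{g • t : g ∈ U}` is
a neighbourhood of `t`. -/
def IsMicroTransitiveAction (G T : Type*) [Group G] [TopologicalSpace G] [TopologicalSpace T]
    [MulAction G T] : Prop :=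
  ∀ U ∈ 𝓝 (1 : G), ∀ t : T, (fun g : G => g • t) '' U ∈ 𝓝 t

/-- The topology of the operator norm on the group of surjective linear isometries. -/
instance isometryGroupTopology : TopologicalSpace (X ≃ₗᵢ[𝕜] X) :=
  TopologicalSpace.induced (fun g => (g : X →L[𝕜] X)) inferInstance

/-- The canonical action of the group of surjective linear isometries on the unit sphere. -/
instance isometryGroupAction : MulAction (X ≃ₗᵢ[𝕜] X) (sphere (0 : X) 1) where
  smul g x := ⟨g x, by simp⟩
  one_smul _ := rfl
  mul_smul _ _ _ := rfl

/-- The norm of `X` is micro-transitive. -/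
def HasMicroTransitiveNorm : Prop :=
  IsMicroTransitiveAction (X ≃ₗᵢ[𝕜] X) (sphere (0 : X) 1)

/-- The Bishop-Phelps-Bollobás point property for numerical radius. -/
def HasBPBppNu : Prop :=
  ∀ ε : ℝ, 0 < ε → ∃ η : ℝ, 0 < η ∧
    ∀ T : X →L[𝕜] X, numericalRadius T = 1 →
      ∀ (x : X) (f : StrongDual 𝕜 X), (x, f) ∈ states 𝕜 X → 1 - η < ‖f (T x)‖ →
        ∃ S : X →L[𝕜] X, numericalRadius S = 1 ∧ ‖f (S x)‖ = 1 ∧ ‖S - T‖ < ε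

end NumRadius

end

/-!
The proof has two halves: the geometry of a space with micro-transitive norm, and a perturbation
argument of Bishop-Phelps-Bollobás type.

*Geometry.* Transitivity of the isometry group makes micro-transitivity uniform: if `x` and `y` are
close in the unit sphere, some isometry close to the identity maps `x` to `y`. Transporting states
by such isometries shows that every `x` in the sphere has only one state `(x, f)`, and that `f`
depends uniformly continuously on `x`; so the norm is uniformly smooth
(`HasUniformlyContinuousDuality.isUniformlySmooth`). A uniformly smooth Banach space is reflexive,
by a duality argument through uniform convexity of the dual
(`IsUniformlySmooth.surjective_inclusionInDoubleDual`). In a separable reflexive space the Baire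
category theorem gives slices of the unit ball of arbitrarily small diameter
(`exists_slice_subset_closedBall`); a reduction to a separable subspace and transitivity then yield
slices of uniformly small diameter at every state, which is uniform convexity
(`HasMicroTransitiveNorm.exists_slice_subset_ball`).

*Perturbation.* If `(x, f)` almost attains the numerical radius of `T`, adding a small multiple of
`f ⊗ x` forces the states almost attaining the numerical radius of the new operator to stay, up to a
unimodular scalar, close to `(x, f)`, by uniform convexity. Iterating, one finds `S` close to `T`
attaining its numerical radius at a state `(z, k)` close to `(x, f)`
(`HasMicroTransitiveNorm.exists_attaining`). Conjugating `S` by an isometry close to the identity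
that maps `x` to `z` moves the point of attainment to `x`, and its functional to `f`, the only
state at `x`. The cost of the conjugation is proportional to `‖S‖`. A positive second numerical
index bounds it: modulo an operator of numerical radius `0`, which affects none of the values at
states, the norm of `T` is bounded.
-/

namespace NumRadius

/-! ### Uniform smoothness and reflexivity -/

section Smooth

variable (𝕜 : Type*) [RCLike 𝕜] (E : Type*) [NormedAddCommGroup E] [NormedSpace 𝕜 E]

/-- Uniform smoothness of the norm, in the form `‖x + t h‖ + ‖x - t h‖ ≤ 2 + o(t)`, uniformly for
`x` in the unit sphere and `h` in the unit ball. -/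
def IsUniformlySmooth : Prop :=
  ∀ ε : ℝ, 0 < ε → ∃ t : ℝ, 0 < t ∧ ∀ x h : E, ‖x‖ = 1 → ‖h‖ ≤ 1 →
    ‖x + (t : 𝕜) • h‖ + ‖x - (t : 𝕜) • h‖ ≤ 2 + t * ε

variable {𝕜 E}

theorem re_apply_le (f : StrongDual 𝕜 E) {x : E} (hx : ‖x‖ ≤ 1) : RCLike.re (f x) ≤ ‖f‖ :=
  (RCLike.re_le_norm _).trans (f.unit_le_opNorm x hx)

theorem exists_lt_re_apply (f : StrongDual 𝕜 E) {r : ℝ} (hr : r < ‖f‖) :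
    ∃ x : E, ‖x‖ ≤ 1 ∧ r < RCLike.re (f x) := by
  obtain ⟨x, hx, hrx⟩ := f.exists_lt_apply_of_lt_opNorm hr
  obtain ⟨c, hc, hcx⟩ := RCLike.exists_norm_eq_mul_self (f x)
  refine ⟨c • x, by rw [norm_smul, hc, one_mul]; exact hx.le, ?_⟩
  rw [map_smul, smul_eq_mul, ← hcx, RCLike.ofReal_re]
  exact hrx

theorem norm_inv_norm_smul {x : E} (hx : x ≠ 0) : ‖((‖x‖⁻¹ : ℝ) : 𝕜) • x‖ = 1 := by
  simp [norm_smul, hx]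

theorem exists_norm_eq_one_lt_re_apply (f : StrongDual 𝕜 E) {r : ℝ} (h0 : 0 ≤ r) (hr : r < ‖f‖) :
    ∃ x : E, ‖x‖ = 1 ∧ r < RCLike.re (f x) := by
  obtain ⟨x, hx, hrx⟩ := exists_lt_re_apply f hr
  have hx0 : x ≠ 0 := by rintro rfl; simp at hrx; linarith
  refine ⟨((‖x‖⁻¹ : ℝ) : 𝕜) • x, norm_inv_norm_smul hx0, hrx.trans_le ?_⟩
  rw [map_smul, smul_eq_mul, RCLike.re_ofReal_mul]
  exact le_mul_of_one_le_left (h0.trans hrx.le) ((one_le_inv₀ (norm_pos_iff.2 hx0)).2 hx)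

theorem re_apply_add_smul (f : StrongDual 𝕜 E) (x h : E) (t : ℝ) :
    RCLike.re (f (x + (t : 𝕜) • h)) = RCLike.re (f x) + t * RCLike.re (f h) := by
  simp

theorem re_apply_sub_smul (f : StrongDual 𝕜 E) (x h : E) (t : ℝ) :
    RCLike.re (f (x - (t : 𝕜) • h)) = RCLike.re (f x) - t * RCLike.re (f h) := by
  simp

theorem IsUniformlySmooth.submodule (hE : IsUniformlySmooth 𝕜 E) (Y : Submodule 𝕜 E) :
    IsUniformlySmooth 𝕜 Y := fun ε hε =>
  let ⟨t, ht, H⟩ := hE ε hε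
  ⟨t, ht, fun x h hx hh => H x h hx hh⟩

/-- Test the smoothness inequality on `x`, `h` such that `f + g` almost attains its norm at `x`, and
`f - g` at `h`: if `‖f + g‖` is almost `2`, then `‖f - g‖` is small. -/
theorem IsUniformlySmooth.uniformConvexSpace_dual (hE : IsUniformlySmooth 𝕜 E) :
    UniformConvexSpace (StrongDual 𝕜 E) := by
  refine ⟨fun ε hε => ?_⟩
  obtain ⟨t, ht, H⟩ := hE (ε / 4) (by positivity)
  -- The bound by `1` makes the value that `re ((f + g) x)` has to exceed nonnegative, so that `x` can
  -- be taken of norm exactly `1`.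
  refine ⟨min (t * ε / 4) 1, by positivity, fun f hf g hg hfg => ?_⟩
  by_contra! hlt
  have hm1 := min_le_left (t * ε / 4) 1
  have hm2 := min_le_right (t * ε / 4) 1
  obtain ⟨x, hx, hx'⟩ := exists_norm_eq_one_lt_re_apply (f + g) (by linarith) hlt
  obtain ⟨h, hh, hh'⟩ := exists_lt_re_apply (f - g) (r := ε * (3 / 4)) (by linarith)
  have h1 := (RCLike.re_le_norm _).trans (f.le_opNorm (x + (t : 𝕜) • h))
  have h2 := (RCLike.re_le_norm _).trans (g.le_opNorm (x - (t : 𝕜) • h))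
  rw [re_apply_add_smul, hf] at h1
  rw [re_apply_sub_smul, hg] at h2
  have h3 := H x h hx hh
  simp only [add_apply, sub_apply, map_add, map_sub]
    at hx' hh'
  nlinarith

/-- With `x`, `y` in the unit ball where `F + t K` and `F - t K` almost attain their norms, the sum
of these norms is almost at most `‖x + y‖ + t ‖x - y‖`. If `‖x - y‖ ≥ ε`, uniform convexity bounds this
by `2 - δ + 2 t`. -/
theorem isUniformlySmooth_dual [UniformConvexSpace E] :
    IsUniformlySmooth 𝕜 (StrongDual 𝕜 E) := by
  intro ε hε
  let _ : NormedSpace ℝ E := NormedSpace.restrictScalars ℝ 𝕜 E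
  obtain ⟨δ, hδ, H⟩ := exists_forall_closed_ball_dist_add_le_two_sub E hε
  refine ⟨δ / 2, by positivity, fun F K hF hK => ?_⟩
  refine le_of_forall_pos_le_add fun s hs => ?_
  obtain ⟨x, hx, hx'⟩ := exists_lt_re_apply (F + ((δ / 2 : ℝ) : 𝕜) • K)
    (sub_lt_self _ (half_pos hs))
  obtain ⟨y, hy, hy'⟩ := exists_lt_re_apply (F - ((δ / 2 : ℝ) : 𝕜) • K)
    (sub_lt_self _ (half_pos hs))
  have e1 : RCLike.re ((F + ((δ / 2 : ℝ) : 𝕜) • K) x)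
      = RCLike.re (F x) + δ / 2 * RCLike.re (K x) := by
    rw [add_apply, smul_apply, map_add, smul_eq_mul,
      RCLike.re_ofReal_mul]
  have e2 : RCLike.re ((F - ((δ / 2 : ℝ) : 𝕜) • K) y)
      = RCLike.re (F y) - δ / 2 * RCLike.re (K y) := by
    rw [sub_apply, smul_apply, map_sub, smul_eq_mul,
      RCLike.re_ofReal_mul]
  rw [e1] at hx'
  rw [e2] at hy'
  have hFs := (RCLike.re_le_norm _).trans (F.le_opNorm (x + y))
  have hKs := (RCLike.re_le_norm _).trans (K.le_opNorm (x - y))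
  rw [map_add, map_add, hF, one_mul] at hFs
  rw [map_sub, map_sub] at hKs
  have hKs' : RCLike.re (K x) - RCLike.re (K y) ≤ ‖x - y‖ :=
    hKs.trans (mul_le_of_le_one_left (norm_nonneg _) hK)
  have hxy : ‖x - y‖ ≤ 2 := (norm_sub_le _ _).trans (by linarith)
  have hxy' : ‖x + y‖ ≤ 2 := (norm_add_le _ _).trans (by linarith)
  have hδK : δ / 2 * (RCLike.re (K x) - RCLike.re (K y)) ≤ δ / 2 * ‖x - y‖ := by gcongr
  rcases le_or_gt ε ‖x - y‖ with h | h
  · have := H hx hy h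
    nlinarith
  · nlinarith

theorem exists_dual_eq_zero_of_isClosed (p : Submodule 𝕜 E) (hp : IsClosed (p : Set E)) {x : E}
    (hx : x ∉ p) : ∃ φ : StrongDual 𝕜 E, ‖φ‖ = 1 ∧ ∀ y ∈ p, φ y = 0 := by
  have hx' : ‖p.mkQ x‖ ≠ 0 := fun h =>
    hx <| by
    have h1 := (QuotientAddGroup.norm_mk_eq_zero_iff_mem_closure (S := p.toAddSubgroup)).1 h
    rwa [Submodule.coe_toAddSubgroup, hp.closure_eq] at h1
  obtain ⟨ψ, -, hψ⟩ := exists_dual_vector 𝕜 (p.mkQ x) hx'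
  set φ : StrongDual 𝕜 E := ψ.comp p.mkQL
  have hφ : φ ≠ 0 := fun h => by
    have : φ x = (‖p.mkQ x‖ : 𝕜) := hψ
    rw [h, zero_apply] at this
    exact hx' (by exact_mod_cast this.symm)
  refine ⟨((‖φ‖⁻¹ : ℝ) : 𝕜) • φ, norm_inv_norm_smul hφ, fun y hy => ?_⟩
  have : p.mkQ y = 0 := (Submodule.Quotient.mk_eq_zero p).2 hy
  change _ * ψ (p.mkQ y) = 0
  rw [this, map_zero, mul_zero]

/-- If the bidual of `E` is uniformly convex, then its unit sphere is contained in the closure of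
the unit ball of `E`: a unit vector `φ` of the bidual and `f` in the unit ball of `E` are close as
soon as both almost attain their norm at the same functional. -/
theorem exists_norm_sub_inclusionInDoubleDual_lt
    [UniformConvexSpace (StrongDual 𝕜 (StrongDual 𝕜 E))] (φ : StrongDual 𝕜 (StrongDual 𝕜 E))
    (hφ : ‖φ‖ = 1) {ε : ℝ} (hε : 0 < ε) :
    ∃ f : E, ‖φ - NormedSpace.inclusionInDoubleDual 𝕜 E f‖ < ε := by
  let _ : NormedSpace ℝ (StrongDual 𝕜 (StrongDual 𝕜 E)) := NormedSpace.restrictScalars ℝ 𝕜 _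
  obtain ⟨δ, hδ, H⟩ :=
    exists_forall_closed_ball_dist_add_le_two_sub (StrongDual 𝕜 (StrongDual 𝕜 E)) hε
  obtain ⟨F, hF, hF'⟩ := exists_lt_re_apply φ (r := 1 - δ / 4) (by rw [hφ]; linarith)
  have hFn : 1 - δ / 4 < ‖F‖ := by
    have := (RCLike.re_le_norm _).trans (φ.le_opNorm F)
    rw [hφ] at this
    linarith
  obtain ⟨f, hf, hf'⟩ := exists_lt_re_apply F hFn
  refine ⟨f, ?_⟩
  by_contra! h
  have h1 := H hφ.le ((NormedSpace.double_dual_bound 𝕜 E f).trans hf) h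
  have h2 := re_apply_le (φ + NormedSpace.inclusionInDoubleDual 𝕜 E f) hF
  rw [add_apply, map_add, NormedSpace.dual_def] at h2
  linarith

/-- If the bidual of `E` is uniformly convex, then a closed norming subspace of the dual of `E` is
everything: a unit vector `φ` of the bidual that vanishes on `p` would be close in norm to an
element of `E`, and that element is small because `p` is norming. -/
theorem eq_top_of_norming [UniformConvexSpace (StrongDual 𝕜 (StrongDual 𝕜 E))]
    (p : Submodule 𝕜 (StrongDual 𝕜 E)) (hp : IsClosed (p : Set (StrongDual 𝕜 E)))
    (hnorming : ∀ (f : E) (c : ℝ), 0 ≤ c → (∀ F ∈ p, ‖F f‖ ≤ c * ‖F‖) → ‖f‖ ≤ c) : p = ⊤ := by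
  by_contra hne
  obtain ⟨F₀, hF₀⟩ : ∃ F₀, F₀ ∉ p := by
    by_contra! hall
    exact hne (eq_top_iff.2 fun F _ => hall F)
  obtain ⟨φ, hφ1, hφ⟩ := exists_dual_eq_zero_of_isClosed p hp hF₀
  obtain ⟨f, hf⟩ := exists_norm_sub_inclusionInDoubleDual_lt φ hφ1 (ε := 1 / 2) (by norm_num)
  have hfsmall : ‖f‖ ≤ 1 / 2 := by
    refine hnorming f _ (by norm_num) fun F hF => ?_
    have h1 := (φ - NormedSpace.inclusionInDoubleDual 𝕜 E f).le_opNorm F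
    rw [sub_apply, hφ F hF, zero_sub, norm_neg, NormedSpace.dual_def] at h1
    exact h1.trans (by gcongr)
  have h2 := NormedSpace.double_dual_bound 𝕜 E f
  have h3 := norm_le_norm_sub_add φ (NormedSpace.inclusionInDoubleDual 𝕜 E f)
  linarith

/-- A uniformly smooth Banach space is reflexive: its bidual is uniformly smooth as well, so that
its third dual is uniformly convex, and the space is a norming subspace of its bidual. -/
theorem IsUniformlySmooth.surjective_inclusionInDoubleDual [CompleteSpace E]
    (hE : IsUniformlySmooth 𝕜 E) :
    Function.Surjective (NormedSpace.inclusionInDoubleDual 𝕜 E) := by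
  have := hE.uniformConvexSpace_dual
  have := (isUniformlySmooth_dual (𝕜 := 𝕜) (E := StrongDual 𝕜 E)).uniformConvexSpace_dual
  have hclosed : IsClosed (LinearMap.range (NormedSpace.inclusionInDoubleDualLi (E := E)
      𝕜).toLinearMap : Set (StrongDual 𝕜 (StrongDual 𝕜 E))) :=
    (NormedSpace.inclusionInDoubleDualLi (E := E)
      𝕜).isometry.isUniformInducing.isComplete_range.isClosed
  refine LinearMap.range_eq_top.1 (eq_top_of_norming (E := StrongDual 𝕜 E) _ hclosed ?_)
  refine fun f c hc h => f.opNorm_le_bound hc fun x => ?_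
  have h1 := h _ ⟨x, rfl⟩
  have h2 : ‖NormedSpace.inclusionInDoubleDualLi (E := E) 𝕜 x‖ = ‖x‖ := LinearIsometry.norm_map _ x
  exact h1.trans_eq (congrArg _ h2)

/-- The easy direction of James' theorem, by reflexivity. -/
theorem IsUniformlySmooth.exists_apply_eq_norm [CompleteSpace E] (hE : IsUniformlySmooth 𝕜 E)
    (f : StrongDual 𝕜 E) : ∃ x : E, ‖x‖ ≤ 1 ∧ f x = ‖f‖ := by
  obtain ⟨F, hF, hFf⟩ := exists_dual_vector'' 𝕜 f
  obtain ⟨x, rfl⟩ := hE.surjective_inclusionInDoubleDual F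
  have h : ‖NormedSpace.inclusionInDoubleDualLi (E := E) 𝕜 x‖ = ‖x‖ := LinearIsometry.norm_map _ x
  exact ⟨x, h ▸ hF, hFf⟩

end Smooth

section Slices

variable {𝕜 : Type*} [RCLike 𝕜] {E : Type*} [NormedAddCommGroup E] [NormedSpace 𝕜 E]

variable (𝕜 E) in
/-- The duality mapping of `E`, taking a point `x` of the unit sphere to the functionals `f` with
`(x, f)` a state, is single-valued and uniformly continuous. Single-valuedness is the case
`x = y`. -/
def HasUniformlyContinuousDuality : Prop :=
  ∀ ε : ℝ, 0 < ε → ∃ δ : ℝ, 0 < δ ∧ ∀ (x y : E) (f g : StrongDual 𝕜 E),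
    (x, f) ∈ states 𝕜 E → (y, g) ∈ states 𝕜 E → ‖x - y‖ < δ → ‖f - g‖ < ε

theorem mem_states_iff {x : E} {f : StrongDual 𝕜 E} :
    (x, f) ∈ states 𝕜 E ↔ ‖x‖ = 1 ∧ ‖f‖ = 1 ∧ f x = 1 := by
  simp [states]

theorem exists_mem_states_apply_eq_norm {x : E} (hx : x ≠ 0) :
    ∃ f : StrongDual 𝕜 E, (((‖x‖⁻¹ : ℝ) : 𝕜) • x, f) ∈ states 𝕜 E ∧ f x = ‖x‖ := by
  have hx' : ‖x‖ ≠ 0 := norm_ne_zero_iff.2 hx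
  obtain ⟨f, hf, hfx⟩ := exists_dual_vector 𝕜 x hx'
  refine ⟨f, mem_states_iff.2 ⟨norm_inv_norm_smul hx, hf, ?_⟩, hfx⟩
  rw [map_smul, hfx, smul_eq_mul, ← RCLike.ofReal_mul, inv_mul_cancel₀ hx', RCLike.ofReal_one]

theorem exists_mem_states {x : E} (hx : ‖x‖ = 1) :
    ∃ f : StrongDual 𝕜 E, (x, f) ∈ states 𝕜 E := by
  obtain ⟨f, hf, hfx⟩ := exists_dual_vector 𝕜 x (by simp [hx])
  exact ⟨f, mem_states_iff.2 ⟨hx, hf, by simp [hfx, hx]⟩⟩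

theorem norm_sub_inv_norm_smul_le {x y : E} (hx : ‖x‖ = 1) (hy : y ≠ 0) :
    ‖x - ((‖y‖⁻¹ : ℝ) : 𝕜) • y‖ ≤ 2 * ‖x - y‖ := by
  have hy' : ‖y‖ ≠ 0 := norm_ne_zero_iff.2 hy
  have h1 : ‖y - ((‖y‖⁻¹ : ℝ) : 𝕜) • y‖ = |‖y‖ - ‖x‖| := by
    have : y - ((‖y‖⁻¹ : ℝ) : 𝕜) • y = ((1 - ‖y‖⁻¹ : ℝ) : 𝕜) • y := by
      rw [RCLike.ofReal_sub, sub_smul, RCLike.ofReal_one, one_smul]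
    rw [this, norm_smul, RCLike.norm_ofReal, hx, ← abs_norm y, ← abs_mul, abs_norm, sub_mul,
      inv_mul_cancel₀ hy', one_mul]
  have h2 := abs_norm_sub_norm_le y x
  rw [norm_sub_rev] at h2
  have h3 := norm_sub_le_norm_sub_add_norm_sub x y (((‖y‖⁻¹ : ℝ) : 𝕜) • y)
  linarith

/-- With states `f`, `g` at the normalizations of `x + t h` and `x - t h`, the sum of the norms of
these vectors is at most `2 + t re ((f - g) h)`. -/
theorem HasUniformlyContinuousDuality.isUniformlySmooth
    (hJ : HasUniformlyContinuousDuality 𝕜 E) : IsUniformlySmooth 𝕜 E := by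
  intro ε hε
  obtain ⟨δ, hδ, H⟩ := hJ ε hε
  set t := min (δ / 8) (1 / 2) with ht
  have ht0 : 0 < t := by positivity
  have ht1 : t ≤ 1 / 2 := min_le_right _ _
  have ht2 : t ≤ δ / 8 := min_le_left _ _
  refine ⟨t, ht0, fun x h hx hh => ?_⟩
  have hth : ‖(t : 𝕜) • h‖ ≤ t := by
    rw [norm_smul, RCLike.norm_ofReal, abs_of_pos ht0]
    exact mul_le_of_le_one_right ht0.le hh
  have hp : x + (t : 𝕜) • h ≠ 0 := fun h0 => by
    rw [eq_neg_of_add_eq_zero_left h0, norm_neg] at hx; linarith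
  have hm : x - (t : 𝕜) • h ≠ 0 := fun h0 => by
    rw [sub_eq_zero.1 h0] at hx; linarith
  obtain ⟨f, hf, hf'⟩ := exists_mem_states_apply_eq_norm (𝕜 := 𝕜) hp
  obtain ⟨g, hg, hg'⟩ := exists_mem_states_apply_eq_norm (𝕜 := 𝕜) hm
  have d1 := norm_sub_inv_norm_smul_le (𝕜 := 𝕜) hx hp
  have d2 := norm_sub_inv_norm_smul_le (𝕜 := 𝕜) hx hm
  rw [sub_add_cancel_left, norm_neg] at d1
  rw [sub_sub_cancel] at d2
  have hfg := H _ _ f g hf hg (by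
    have := norm_sub_le_norm_sub_add_norm_sub (((‖x + (t : 𝕜) • h‖⁻¹ : ℝ) : 𝕜) • (x + (t : 𝕜) • h))
      x (((‖x - (t : 𝕜) • h‖⁻¹ : ℝ) : 𝕜) • (x - (t : 𝕜) • h))
    rw [norm_sub_rev _ x] at this
    linarith)
  obtain ⟨-, hf1, -⟩ := mem_states_iff.1 hf
  obtain ⟨-, hg1, -⟩ := mem_states_iff.1 hg
  have e1 := congrArg RCLike.re hf'
  have e2 := congrArg RCLike.re hg'
  rw [re_apply_add_smul, RCLike.ofReal_re] at e1
  rw [re_apply_sub_smul, RCLike.ofReal_re] at e2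
  have h1 := re_apply_le f hx.le
  have h2 := re_apply_le g hx.le
  have h3 := re_apply_le (f - g) hh
  rw [sub_apply, map_sub] at h3
  nlinarith

/-! ### Small slices from the Baire category theorem -/

/-- If every functional on the separable space `E` attains its norm on the unit ball, then the unit
ball has slices of arbitrarily small diameter. The functionals whose norm is almost attained in a
given closed ball of radius `r` form a closed set, and countably many of these sets cover the dual.
By Baire one of them contains a neighbourhood of some `f`; perturbing `f` in the direction of a
functional `h` then shows that `h` is small on the slices of `f`, up to a translation. -/
theorem exists_slice_subset_closedBall [TopologicalSpace.SeparableSpace E]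
    (hE : ∀ f : StrongDual 𝕜 E, ∃ x : E, ‖x‖ ≤ 1 ∧ f x = ‖f‖) {r : ℝ} (hr : 0 < r) :
    ∃ (f : StrongDual 𝕜 E) (δ : ℝ) (d : E), 0 < δ ∧
      ∀ x : E, ‖x‖ ≤ 1 → ‖f‖ - δ < RCLike.re (f x) → ‖x - d‖ ≤ 2 * r := by
  set A : ℕ → Set (StrongDual 𝕜 E) := fun n => {f | ∀ η : ℝ, 0 < η → ∃ x : E, ‖x‖ ≤ 1 ∧
    ‖x - TopologicalSpace.denseSeq E n‖ ≤ r ∧ ‖f‖ - η < RCLike.re (f x)} with hA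
  have hclosed : ∀ n, IsClosed (A n) := fun n => by
    refine isClosed_of_closure_subset fun f hf η hη => ?_
    obtain ⟨g, hg, hfg⟩ := Metric.mem_closure_iff.1 hf (η / 4) (by positivity)
    obtain ⟨x, hx, hxd, hgx⟩ := hg (η / 4) (by positivity)
    refine ⟨x, hx, hxd, ?_⟩
    rw [dist_eq_norm] at hfg
    have h1 := re_apply_le (g - f) hx
    rw [sub_apply, map_sub, norm_sub_rev] at h1
    have h2 := norm_sub_norm_le f g
    linarith
  have hcover : ⋃ n, A n = univ := by
    refine eq_univ_of_forall fun f => ?_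
    obtain ⟨x, hx, hfx⟩ := hE f
    obtain ⟨n, hn⟩ := (TopologicalSpace.denseRange_denseSeq E).exists_dist_lt x hr
    refine mem_iUnion.2 ⟨n, fun η hη => ⟨x, hx, by rw [← dist_eq_norm]; exact hn.le, ?_⟩⟩
    rw [hfx, RCLike.ofReal_re]
    linarith
  -- A ball of radius `ρ` around `f` is contained in `A n`.
  obtain ⟨n, f, hf⟩ := nonempty_interior_of_iUnion_of_closed hclosed hcover
  obtain ⟨ρ, hρ, hball⟩ := Metric.isOpen_iff.1 isOpen_interior f hf
  set d := TopologicalSpace.denseSeq E n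
  refine ⟨f, ρ / 2 * (r / 2), d, by positivity, fun x hx hfx => ?_⟩
  obtain ⟨h, hh, hhx⟩ := exists_dual_vector'' 𝕜 (x - d)
  have hmem : f + ((ρ / 2 : ℝ) : 𝕜) • h ∈ A n := by
    refine interior_subset (hball ?_)
    rw [mem_ball_iff_norm, add_sub_cancel_left, norm_smul, RCLike.norm_ofReal,
      abs_of_pos (by positivity)]
    nlinarith
  obtain ⟨y, hy, hyd, hy'⟩ := hmem (ρ / 2 * (r / 2)) (by positivity)
  have e : ∀ z, RCLike.re ((f + ((ρ / 2 : ℝ) : 𝕜) • h) z)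
      = RCLike.re (f z) + ρ / 2 * RCLike.re (h z) := fun z => by
    rw [add_apply, smul_apply, map_add, smul_eq_mul, RCLike.re_ofReal_mul]
  have h1 := re_apply_le (f + ((ρ / 2 : ℝ) : 𝕜) • h) hx
  rw [e] at h1 hy'
  have h2 := re_apply_le f hy
  have h3 := congrArg RCLike.re hhx
  rw [map_sub, map_sub, RCLike.ofReal_re] at h3
  have h4 := (RCLike.re_le_norm _).trans (h.le_opNorm (y - d))
  rw [map_sub, map_sub] at h4
  have h5 : ‖h‖ * ‖y - d‖ ≤ r := (mul_le_of_le_one_left (norm_nonneg _) hh).trans hyd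
  have h6 : ρ / 2 * (‖x - d‖ - 2 * r) < 0 := by nlinarith
  by_contra! hlt
  have := mul_pos (half_pos hρ) (sub_pos.2 hlt)
  linarith

/-- A countable set can be enlarged to a countable set that is dense in its linear span and closed
under countably many operations. -/
theorem exists_countable_span_subset_closure (φ : ℕ → E → E) (x : E) :
    ∃ C : Set E, C.Countable ∧ x ∈ C ∧ (∀ y ∈ C, ∀ n, φ n y ∈ C) ∧
      (Submodule.span 𝕜 C : Set E) ⊆ closure C := by
  have hstep : ∀ C : {C : Set E // C.Countable}, ∃ D : {D : Set E // D.Countable},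
      C.1 ⊆ D.1 ∧ (∀ y ∈ C.1, ∀ n, φ n y ∈ D.1) ∧ (Submodule.span 𝕜 C.1 : Set E) ⊆ closure D.1 := by
    rintro ⟨C, hC⟩
    obtain ⟨D, hD, hCD⟩ := (hC.isSeparable.span : TopologicalSpace.IsSeparable
      (Submodule.span 𝕜 C : Set E))
    refine ⟨⟨C ∪ (⋃ n, φ n '' C) ∪ D, (hC.union (countable_iUnion fun n => hC.image _)).union hD⟩,
      fun y hy => Or.inl (Or.inl hy),
      fun y hy n => Or.inl (Or.inr (mem_iUnion.2 ⟨n, y, hy, rfl⟩)),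
      hCD.trans (closure_mono subset_union_right)⟩
  choose step h1 h2 h3 using hstep
  set S : ℕ → {C : Set E // C.Countable} := fun n =>
    Nat.rec ⟨{x}, countable_singleton x⟩ (fun _ C => step C) n with hS
  have hmono : Monotone fun n => (S n).1 := monotone_nat_of_le_succ fun n => h1 (S n)
  refine ⟨⋃ n, (S n).1, countable_iUnion fun n => (S n).2, mem_iUnion.2 ⟨0, rfl⟩, ?_, ?_⟩
  · intro y hy n
    obtain ⟨k, hk⟩ := mem_iUnion.1 hy
    exact mem_iUnion.2 ⟨k + 1, h2 (S k) y hk n⟩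
  · rw [Submodule.span_iUnion, Submodule.coe_iSup_of_directed]
    · refine iUnion_subset fun n => (h3 (S n)).trans (closure_mono ?_)
      exact subset_iUnion (fun n => (S n).1) (n + 1)
    · exact Monotone.directed_le fun m n hmn => Submodule.span_mono (hmono hmn)

/-- Slices at points of the unit sphere that are contained in small balls. If there were none of
radius `ε`, this would be witnessed inside a separable closed subspace, which is again uniformly
smooth, hence reflexive, and so has slices of small diameter. -/
theorem HasUniformlyContinuousDuality.exists_slice_subset_ball [CompleteSpace E] [Nontrivial E]
    (hJ : HasUniformlyContinuousDuality 𝕜 E) {ε : ℝ} (hε : 0 < ε) :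
    ∃ (x : E) (f : StrongDual 𝕜 E) (δ : ℝ), (x, f) ∈ states 𝕜 E ∧ 0 < δ ∧
      ∀ y : E, ‖y‖ ≤ 1 → 1 - δ < RCLike.re (f y) → ‖x - y‖ < ε := by
  by_contra! hbad
  have hφ : ∀ (n : ℕ) (x : E), ∃ y : E, x ≠ 0 → ∃ f : StrongDual 𝕜 E,
      (((‖x‖⁻¹ : ℝ) : 𝕜) • x, f) ∈ states 𝕜 E ∧ ‖y‖ ≤ 1 ∧ 1 - 1 / (n + 1 : ℝ) < RCLike.re (f y) ∧
      ε ≤ ‖((‖x‖⁻¹ : ℝ) : 𝕜) • x - y‖ := by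
    intro n x
    by_cases hx : x = 0
    · exact ⟨0, fun h => absurd hx h⟩
    · obtain ⟨f, hf, -⟩ := exists_mem_states_apply_eq_norm (𝕜 := 𝕜) hx
      obtain ⟨y, hy⟩ := hbad _ f _ hf (Nat.one_div_pos_of_nat (n := n))
      exact ⟨y, fun _ => ⟨f, hf, hy⟩⟩
  choose φ hφ using hφ
  obtain ⟨x₀, hx₀⟩ := exists_ne (0 : E)
  obtain ⟨C, hC, hx₀C, hCφ, hCspan⟩ := exists_countable_span_subset_closure (𝕜 := 𝕜) φ x₀
  -- `φ n` maps a nonzero `z` to a point of the `1 / (n + 1)`-slice at the normalization of `z` that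
  -- is far from this normalization. The closed span `Y` of `C` is just the closure of `C`.
  set Y := (Submodule.span 𝕜 C).topologicalClosure with hY
  have hCY : C ⊆ Y := Submodule.subset_span.trans (Submodule.le_topologicalClosure _)
  have hYC : (Y : Set E) ⊆ closure C := by
    rw [hY, Submodule.topologicalClosure_coe]
    exact closure_minimal hCspan isClosed_closure
  have hYsep : TopologicalSpace.SeparableSpace Y :=
    (hC.isSeparable.closure.mono hYC).separableSpace
  have hYcomplete : CompleteSpace Y :=
    (Submodule.isClosed_topologicalClosure _).completeSpace_coe
  have hYsmooth := hJ.isUniformlySmooth.submodule Y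
  obtain ⟨f, δ₀, d, hδ₀, hslice⟩ := exists_slice_subset_closedBall (𝕜 := 𝕜) (E := Y)
    hYsmooth.exists_apply_eq_norm (r := ε / 10) (by positivity)
  -- The slice lies at a state: its functional is a multiple of some `k`, with `(x, k)` a state and
  -- `x` in `Y`. For `f = 0` the slice is the whole ball, and any state will do.
  have hx : ∃ (x : Y) (k : StrongDual 𝕜 E), ((x : E), k) ∈ states 𝕜 E ∧
      ∀ y : Y, f y = ‖f‖ * k y := by
    by_cases hf : f = 0
    · obtain ⟨k, hk, -⟩ := exists_mem_states_apply_eq_norm (𝕜 := 𝕜) hx₀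
      exact ⟨⟨_, Y.smul_mem _ (hCY hx₀C)⟩, k, hk, fun y => by simp [hf]⟩
    · have hf0 : ‖f‖ ≠ 0 := norm_ne_zero_iff.2 hf
      obtain ⟨x, hx, hfx⟩ := hYsmooth.exists_apply_eq_norm f
      obtain ⟨k, hk, hkn⟩ := exists_extension_norm_eq Y (((‖f‖⁻¹ : ℝ) : 𝕜) • f)
      rw [norm_inv_norm_smul hf] at hkn
      have hkf : ∀ y : Y, f y = ‖f‖ * k y := fun y => by
        rw [hk, smul_apply, smul_eq_mul, ← mul_assoc, ← RCLike.ofReal_mul, mul_inv_cancel₀ hf0,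
          RCLike.ofReal_one, one_mul]
      have hkx : k x = 1 := by
        have h := hkf x
        rw [hfx] at h
        exact (mul_right_injective₀ (RCLike.ofReal_ne_zero.2 hf0) ((mul_one _).trans h)).symm
      refine ⟨x, k, mem_states_iff.2 ⟨le_antisymm hx ?_, hkn, hkx⟩, hkf⟩
      have := k.le_opNorm x
      rwa [hkx, hkn, one_mul, norm_one] at this
  obtain ⟨x, k, hxk, hfk⟩ := hx
  obtain ⟨hx1, hk1, hkx⟩ := mem_states_iff.1 hxk
  set δ := δ₀ / (‖f‖ + 1) with hδ
  have hδpos : 0 < δ := by positivity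
  have hslice' : ∀ y : Y, ‖y‖ ≤ 1 → 1 - δ < RCLike.re (k y) → ‖(y : E) - d‖ ≤ 2 * (ε / 10) := by
    intro y hy hky
    refine hslice y hy ?_
    rw [hfk, RCLike.re_ofReal_mul]
    have h1 : δ * (‖f‖ + 1) = δ₀ := by rw [hδ]; field_simp
    nlinarith [norm_nonneg f]
  obtain ⟨ρ, hρ, H⟩ := hJ (δ / 2) (by positivity)
  obtain ⟨n, hn⟩ := exists_nat_one_div_lt (half_pos hδpos)
  -- Approximate `x` by some `z` in `C`. By continuity of the duality mapping, `φ n z` lies in the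
  -- slice of `k`, so that `x` and `φ n z` are too close to each other.
  obtain ⟨z, hzC, hz⟩ := Metric.mem_closure_iff.1 (hYC x.2) (min (min ρ (ε / 2)) 1 / 2)
    (by positivity)
  rw [dist_eq_norm] at hz
  have m1 : min (min ρ (ε / 2)) 1 ≤ ρ := (min_le_left _ _).trans (min_le_left _ _)
  have m2 : min (min ρ (ε / 2)) 1 ≤ ε / 2 := (min_le_left _ _).trans (min_le_right _ _)
  have m3 : min (min ρ (ε / 2)) 1 ≤ 1 := min_le_right _ _
  have hz0 : z ≠ 0 := by
    rintro rfl
    rw [sub_zero, hx1] at hz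
    linarith
  have hxz := norm_sub_inv_norm_smul_le (𝕜 := 𝕜) hx1 hz0
  obtain ⟨g, hg, hφ1, hφ2, hφ3⟩ := hφ n z hz0
  have hkg := H _ _ k g hxk hg (by linarith)
  have hkg' := re_apply_le (g - k) hφ1
  rw [sub_apply, map_sub, norm_sub_rev] at hkg'
  have s1 := hslice' x hx1.le (by rw [hkx, RCLike.one_re]; linarith)
  have s2 := hslice' ⟨φ n z, hCY (hCφ z hzC n)⟩ hφ1 (by change _ < RCLike.re (k (φ n z)); linarith)
  have t1 := norm_sub_le_norm_sub_add_norm_sub (x : E) d (φ n z)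
  have t2 := norm_sub_le_norm_sub_add_norm_sub (((‖z‖⁻¹ : ℝ) : 𝕜) • z) (x : E) (φ n z)
  rw [norm_sub_rev] at s2
  rw [norm_sub_rev _ (x : E)] at t2
  simp only at s2
  linarith

end Slices

section MicroTransitive

variable {𝕜 : Type*} [RCLike 𝕜] {X : Type*} [NormedAddCommGroup X] [NormedSpace 𝕜 X]

/-! ### Geometry of spaces with micro-transitive norm -/

theorem mem_states_comp (g : X ≃ₗᵢ[𝕜] X) {x : X} {f : StrongDual 𝕜 X}
    (h : (g x, f) ∈ states 𝕜 X) : (x, f.comp (g : X →L[𝕜] X)) ∈ states 𝕜 X := by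
  obtain ⟨hx, hf, hfx⟩ := mem_states_iff.1 h
  rw [g.norm_map] at hx
  have hval : f.comp (g : X →L[𝕜] X) x = 1 := hfx
  refine mem_states_iff.2 ⟨hx, le_antisymm ?_ ?_, hval⟩
  · refine ContinuousLinearMap.opNorm_le_bound _ zero_le_one fun y => ?_
    have := f.le_opNorm (g y)
    rwa [g.norm_map, hf] at this
  · have := (f.comp (g : X →L[𝕜] X)).le_opNorm x
    rwa [hval, hx, mul_one, norm_one] at this

theorem norm_isometry_symm_sub_id_le (g : X ≃ₗᵢ[𝕜] X) :
    ‖(g.symm : X →L[𝕜] X) - .id 𝕜 X‖ ≤ ‖(g : X →L[𝕜] X) - .id 𝕜 X‖ := by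
  refine ContinuousLinearMap.opNorm_le_bound _ (norm_nonneg _) fun y => ?_
  have h := ((g : X →L[𝕜] X) - .id 𝕜 X).le_opNorm (g.symm y)
  rw [g.symm.norm_map] at h
  refine le_of_eq_of_le ?_ h
  change ‖g.symm y - y‖ = ‖g (g.symm y) - g.symm y‖
  rw [g.apply_symm_apply, norm_sub_rev]

theorem norm_isometry_conj_sub_id_le (g h : X ≃ₗᵢ[𝕜] X) :
    ‖(((h.symm.trans g).trans h : X ≃ₗᵢ[𝕜] X) : X →L[𝕜] X) - .id 𝕜 X‖
      ≤ ‖(g : X →L[𝕜] X) - .id 𝕜 X‖ := by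
  refine ContinuousLinearMap.opNorm_le_bound _ (norm_nonneg _) fun y => ?_
  have h1 := ((g : X →L[𝕜] X) - .id 𝕜 X).le_opNorm (h.symm y)
  rw [h.symm.norm_map] at h1
  refine le_of_eq_of_le ?_ h1
  change ‖h (g (h.symm y)) - y‖ = ‖g (h.symm y) - h.symm y‖
  rw [← h.norm_map (g (h.symm y) - h.symm y), map_sub, h.apply_symm_apply]

theorem HasMicroTransitiveNorm.exists_isometry_at (hX : HasMicroTransitiveNorm 𝕜 X) {ε : ℝ}
    (hε : 0 < ε) {x : X} (hx : ‖x‖ = 1) :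
    ∃ δ : ℝ, 0 < δ ∧ ∀ y : X, ‖y‖ = 1 → ‖y - x‖ < δ →
      ∃ g : X ≃ₗᵢ[𝕜] X, g x = y ∧ ‖(g : X →L[𝕜] X) - .id 𝕜 X‖ < ε := by
  have hU : {g : X ≃ₗᵢ[𝕜] X | ‖(g : X →L[𝕜] X) - .id 𝕜 X‖ < ε} ∈ 𝓝 (1 : X ≃ₗᵢ[𝕜] X) := by
    rw [nhds_induced]
    refine ⟨ball (.id 𝕜 X) ε, ball_mem_nhds _ hε, fun g hg => ?_⟩
    exact mem_ball_iff_norm.1 hg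
  have hN := hX _ hU ⟨x, by simpa using hx⟩
  obtain ⟨δ, hδ, hball⟩ := Metric.mem_nhds_iff.1 hN
  refine ⟨δ, hδ, fun y hy hyx => ?_⟩
  have hmem : (⟨y, by simpa using hy⟩ : sphere (0 : X) 1) ∈ ball (⟨x, by simpa using hx⟩ :
      sphere (0 : X) 1) δ := by
    rw [mem_ball, Subtype.dist_eq, dist_eq_norm]
    exact hyx
  obtain ⟨g, hg, hgx⟩ := hball hmem
  exact ⟨g, congrArg Subtype.val hgx, hg⟩

/-- The orbits of the isometry group on the unit sphere are open, and the unit sphere is connected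
unless the space is a real line, where `±1` acts transitively. -/
theorem HasMicroTransitiveNorm.exists_isometry (hX : HasMicroTransitiveNorm 𝕜 X) {x y : X}
    (hx : ‖x‖ = 1) (hy : ‖y‖ = 1) : ∃ g : X ≃ₗᵢ[𝕜] X, g x = y := by
  let _ : NormedSpace ℝ X := NormedSpace.restrictScalars ℝ 𝕜 X
  rcases lt_or_ge 1 (Module.rank ℝ X) with hrank | hrank
  · have hopen : ∀ z : X, ‖z‖ = 1 → ∃ δ : ℝ, 0 < δ ∧ ∀ w : X, ‖w‖ = 1 → ‖w - z‖ < δ →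
        ∃ g : X ≃ₗᵢ[𝕜] X, g z = w := fun z hz => by
      obtain ⟨δ, hδ, H⟩ := hX.exists_isometry_at one_pos hz
      exact ⟨δ, hδ, fun w hw hwz => (H w hw hwz).imp fun g hg => hg.1⟩
    have hconn : IsPreconnected (sphere (0 : X) 1) := isPreconnected_sphere hrank 0 1
    have hpc : PreconnectedSpace (sphere (0 : X) 1) := Subtype.preconnectedSpace hconn
    set O : Set (sphere (0 : X) 1) := {z | ∃ g : X ≃ₗᵢ[𝕜] X, g x = z} with hO
    have hOopen : IsOpen O := by
      refine Metric.isOpen_iff.2 fun z hz => ?_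
      obtain ⟨g, hg⟩ := hz
      obtain ⟨δ, hδ, H⟩ := hopen z (by simp)
      refine ⟨δ, hδ, fun w hw => ?_⟩
      rw [mem_ball, Subtype.dist_eq, dist_eq_norm] at hw
      obtain ⟨k, hk⟩ := H w (by simp) hw
      exact ⟨g.trans k, by simp [hg, hk]⟩
    have hOclosed : IsOpen Oᶜ := by
      refine Metric.isOpen_iff.2 fun z hz => ?_
      obtain ⟨δ, hδ, H⟩ := hopen z (by simp)
      refine ⟨δ, hδ, fun w hw => ?_⟩
      rw [mem_ball, Subtype.dist_eq, dist_eq_norm] at hw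
      obtain ⟨k, hk⟩ := H w (by simp) hw
      rintro ⟨g, hg⟩
      exact hz ⟨g.trans k.symm, by simp [hg, ← hk]⟩
    have hne : O.Nonempty := ⟨⟨x, by simpa using hx⟩, 1, rfl⟩
    have huniv := IsClopen.eq_univ ⟨⟨hOclosed⟩, hOopen⟩ hne
    have hmem : (⟨y, by simpa using hy⟩ : sphere (0 : X) 1) ∈ O := huniv ▸ mem_univ _
    exact hmem
  · obtain ⟨v, hv⟩ := rank_le_one_iff.1 hrank
    obtain ⟨a, rfl⟩ := hv x
    obtain ⟨b, rfl⟩ := hv y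
    have hab : |a| * ‖v‖ = |b| * ‖v‖ := by
      rw [← Real.norm_eq_abs, ← Real.norm_eq_abs, ← norm_smul, ← norm_smul, hx, hy]
    have hv0 : ‖v‖ ≠ 0 := fun h => by rw [norm_smul, h, mul_zero] at hx; exact zero_ne_one hx
    rcases abs_eq_abs.1 (mul_right_cancel₀ hv0 hab) with h | h
    · exact ⟨.refl 𝕜 X, by simp [h]⟩
    · exact ⟨.neg 𝕜, by simp [h]⟩

/-- Micro-transitivity holds uniformly over the unit sphere: conjugation by isometries preserves
the distance to the identity, and the action is transitive. -/
theorem HasMicroTransitiveNorm.exists_isometry_near_id (hX : HasMicroTransitiveNorm 𝕜 X) {ε : ℝ}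
    (hε : 0 < ε) :
    ∃ δ : ℝ, 0 < δ ∧ ∀ x y : X, ‖x‖ = 1 → ‖y‖ = 1 → ‖x - y‖ < δ →
      ∃ g : X ≃ₗᵢ[𝕜] X, g x = y ∧ ‖(g : X →L[𝕜] X) - .id 𝕜 X‖ < ε := by
  by_cases hne : ∃ x₀ : X, ‖x₀‖ = 1
  · obtain ⟨x₀, hx₀⟩ := hne
    obtain ⟨δ, hδ, H⟩ := hX.exists_isometry_at hε hx₀
    refine ⟨δ, hδ, fun x y hx hy hxy => ?_⟩
    obtain ⟨h, rfl⟩ := hX.exists_isometry hx₀ hx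
    obtain ⟨g, hg, hgn⟩ := H (h.symm y) (by rw [h.symm.norm_map, hy]) (by
      rw [← h.norm_map, map_sub, h.apply_symm_apply, norm_sub_rev]; exact hxy)
    refine ⟨(h.symm.trans g).trans h, ?_, (norm_isometry_conj_sub_id_le g h).trans_lt hgn⟩
    simp [hg]
  · exact ⟨1, one_pos, fun x _ hx => absurd ⟨x, hx⟩ hne⟩

/-- A micro-transitive norm is smooth. If `f` and `f'` are states at `x`, then a state `k` at the
normalization of `x + t h` satisfies `re (f h) ≤ re (k h)` for `t > 0`; moving `f'` by a small
isometry yields such a `k` close to `f'`. -/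
theorem HasMicroTransitiveNorm.eq_of_mem_states (hX : HasMicroTransitiveNorm 𝕜 X) {x : X}
    {f f' : StrongDual 𝕜 X} (hf : (x, f) ∈ states 𝕜 X) (hf' : (x, f') ∈ states 𝕜 X) :
    f = f' := by
  obtain ⟨hx, hf1, hfx⟩ := mem_states_iff.1 hf
  obtain ⟨-, hf1', hfx'⟩ := mem_states_iff.1 hf'
  have key : ∀ h : X, RCLike.re (f h) ≤ RCLike.re (f' h) := by
    intro h
    refine le_of_forall_pos_le_add fun ε hε => ?_
    obtain ⟨δ, hδ, H⟩ := hX.exists_isometry_at (ε := ε / (‖h‖ + 1)) (by positivity) hx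
    set t := min (δ / 4) (1 / 2) / (‖h‖ + 1) with ht
    have ht0 : 0 < t := by positivity
    have hth : ‖(t : 𝕜) • h‖ ≤ min (δ / 4) (1 / 2) := by
      rw [norm_smul, RCLike.norm_ofReal, abs_of_pos ht0]
      have h1 : t * (‖h‖ + 1) = min (δ / 4) (1 / 2) := by rw [ht]; field_simp
      nlinarith
    have m1 := min_le_left (δ / 4) (1 / 2)
    have m2 := min_le_right (δ / 4) (1 / 2)
    set u := x + (t : 𝕜) • h with hu
    have hu0 : u ≠ 0 := fun h0 => by
      rw [eq_neg_of_add_eq_zero_left h0, norm_neg] at hx; linarith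
    have hxu : ‖x - u‖ ≤ δ / 4 := by
      rw [hu, sub_add_cancel_left, norm_neg]; exact hth.trans m1
    have hxu' := norm_sub_inv_norm_smul_le (𝕜 := 𝕜) hx hu0
    obtain ⟨g, hg, hgn⟩ := H (((‖u‖⁻¹ : ℝ) : 𝕜) • u) (norm_inv_norm_smul hu0) (by
      rw [norm_sub_rev]; linarith)
    have hk : (((‖u‖⁻¹ : ℝ) : 𝕜) • u, f'.comp (g.symm : X →L[𝕜] X)) ∈ states 𝕜 X := by
      refine mem_states_comp g.symm ?_
      rwa [← hg, g.symm_apply_apply]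
    obtain ⟨-, hk1, hku⟩ := mem_states_iff.1 hk
    set k := f'.comp (g.symm : X →L[𝕜] X) with hkdef
    have hku' : k u = ‖u‖ := by
      have hun : ‖u‖ ≠ 0 := norm_ne_zero_iff.2 hu0
      rw [map_smul, smul_eq_mul] at hku
      calc k u = (‖u‖ : 𝕜) * (((‖u‖⁻¹ : ℝ) : 𝕜) * k u) := by
            rw [← mul_assoc, ← RCLike.ofReal_mul, mul_inv_cancel₀ hun, RCLike.ofReal_one, one_mul]
        _ = ‖u‖ := by rw [hku, mul_one]
    have e1 : RCLike.re (k u) = ‖u‖ := by rw [hku', RCLike.ofReal_re]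
    have e2 : RCLike.re (f u) ≤ ‖u‖ := by
      have := (RCLike.re_le_norm _).trans (f.le_opNorm u)
      rwa [hf1, one_mul] at this
    have e3 := re_apply_le k hx.le
    rw [hu, re_apply_add_smul] at e1 e2
    rw [hfx, RCLike.one_re] at e2
    rw [hk1] at e3
    have e4 : RCLike.re (f h) ≤ RCLike.re (k h) := le_of_mul_le_mul_left (by linarith) ht0
    have e5 : RCLike.re (k h) - RCLike.re (f' h) ≤ ε := by
      have h1 : k h - f' h = f' (((g.symm : X →L[𝕜] X) - .id 𝕜 X) h) := by
        rw [sub_apply, map_sub]; rfl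
      rw [← map_sub, h1]
      refine (RCLike.re_le_norm _).trans ((f'.le_opNorm _).trans ?_)
      rw [hf1', one_mul]
      refine (ContinuousLinearMap.le_opNorm _ _).trans ?_
      have h2 := (norm_isometry_symm_sub_id_le g).trans hgn.le
      calc _ ≤ ε / (‖h‖ + 1) * (‖h‖ + 1) := by gcongr; linarith
        _ = ε := by field_simp
    linarith
  refine sub_eq_zero.1 (norm_le_zero_iff.1 (le_of_forall_lt fun r hr => ?_))
  obtain ⟨h, -, hh⟩ := exists_lt_re_apply (f - f') hr
  have := key h
  rw [sub_apply, map_sub] at hh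
  linarith

theorem HasMicroTransitiveNorm.hasUniformlyContinuousDuality (hX : HasMicroTransitiveNorm 𝕜 X) :
    HasUniformlyContinuousDuality 𝕜 X := by
  intro ε hε
  obtain ⟨δ, hδ, H⟩ := hX.exists_isometry_near_id hε
  refine ⟨δ, hδ, fun x y f k hxf hyk hxy => ?_⟩
  obtain ⟨hx, -, -⟩ := mem_states_iff.1 hxf
  obtain ⟨hy, hk, -⟩ := mem_states_iff.1 hyk
  obtain ⟨g, rfl, hgn⟩ := H x y hx hy hxy
  rw [hX.eq_of_mem_states hxf (mem_states_comp g hyk)]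
  have h1 : k.comp (g : X →L[𝕜] X) - k = k.comp ((g : X →L[𝕜] X) - .id 𝕜 X) := by
    rw [ContinuousLinearMap.comp_sub]; rfl
  rw [h1]
  refine (ContinuousLinearMap.opNorm_comp_le _ _).trans_lt ?_
  rwa [hk, one_mul]

/-- The norm is uniformly convex, in the form that the slices of the unit ball at states are
uniformly small: by transitivity it suffices to have one state for each radius. -/
theorem HasMicroTransitiveNorm.exists_slice_subset_ball [CompleteSpace X]
    (hX : HasMicroTransitiveNorm 𝕜 X) {ε : ℝ} (hε : 0 < ε) :
    ∃ δ : ℝ, 0 < δ ∧ ∀ (x y : X) (f : StrongDual 𝕜 X), (x, f) ∈ states 𝕜 X → ‖y‖ ≤ 1 →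
      1 - δ < RCLike.re (f y) → ‖x - y‖ < ε := by
  rcases subsingleton_or_nontrivial X with hs | hn
  · exact ⟨1, one_pos, fun x y _ _ _ _ => by rw [Subsingleton.elim (x - y) 0, norm_zero]; exact hε⟩
  · obtain ⟨x₀, f₀, δ, hxf₀, hδ, H⟩ := hX.hasUniformlyContinuousDuality.exists_slice_subset_ball hε
    refine ⟨δ, hδ, fun x y f hxf hy hfy => ?_⟩
    obtain ⟨hx, -, -⟩ := mem_states_iff.1 hxf
    obtain ⟨hx₀, -, -⟩ := mem_states_iff.1 hxf₀
    obtain ⟨g, rfl⟩ := hX.exists_isometry hx₀ hx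
    have hf := hX.eq_of_mem_states hxf₀ (mem_states_comp g hxf)
    have h := H (g.symm y) (by rwa [g.symm.norm_map]) (by
      rw [hf]
      change _ < RCLike.re (f (g (g.symm y)))
      rwa [g.apply_symm_apply])
    rwa [← g.norm_map, map_sub, g.apply_symm_apply] at h

end MicroTransitive

section Attaining

variable {𝕜 : Type*} [RCLike 𝕜] {X : Type*} [NormedAddCommGroup X] [NormedSpace 𝕜 X]

/-! ### Operators attaining their numerical radius -/

theorem norm_apply_le_numericalRadius (T : X →L[𝕜] X) {x : X} {f : StrongDual 𝕜 X}
    (h : (x, f) ∈ states 𝕜 X) : ‖f (T x)‖ ≤ numericalRadius T :=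
  le_ciSup (bddAbove_range_state T) (⟨(x, f), h⟩ : states 𝕜 X)

theorem numericalRadius_le {T : X →L[𝕜] X} {c : ℝ} (hc : 0 ≤ c)
    (h : ∀ (x : X) (f : StrongDual 𝕜 X), (x, f) ∈ states 𝕜 X → ‖f (T x)‖ ≤ c) :
    numericalRadius T ≤ c :=
  Real.iSup_le (fun p => h p.1.1 p.1.2 p.2) hc

theorem numericalRadius_le_add_norm_sub (S T : X →L[𝕜] X) :
    numericalRadius S ≤ numericalRadius T + ‖S - T‖ := by
  refine numericalRadius_le (add_nonneg (numericalRadius_nonneg T) (norm_nonneg _))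
    fun x f h => ?_
  have h1 := norm_apply_le_norm (S - T) ⟨(x, f), h⟩
  have h2 := norm_apply_le_numericalRadius T h
  have h3 : f (S x) = f (T x) + f ((S - T) x) := by simp
  rw [h3]
  exact (norm_add_le _ _).trans (add_le_add h2 h1)

theorem exists_lt_norm_apply {x : X} {f : StrongDual 𝕜 X} (h : (x, f) ∈ states 𝕜 X)
    (T : X →L[𝕜] X) {r : ℝ} (hr : r < numericalRadius T) :
    ∃ (y : X) (g : StrongDual 𝕜 X), (y, g) ∈ states 𝕜 X ∧ r < ‖g (T y)‖ := by
  have : Nonempty (states 𝕜 X) := ⟨⟨_, h⟩⟩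
  obtain ⟨⟨⟨y, g⟩, hp⟩, hr'⟩ := exists_lt_of_lt_ciSup hr
  exact ⟨y, g, hp, hr'⟩

theorem mem_states_smul {x : X} {f : StrongDual 𝕜 X} (h : (x, f) ∈ states 𝕜 X) {c : 𝕜}
    (hc : ‖c‖ = 1) : (c • x, c⁻¹ • f) ∈ states 𝕜 X := by
  obtain ⟨hx, hf, hfx⟩ := mem_states_iff.1 h
  have hc0 : c ≠ 0 := by rintro rfl; simp at hc
  refine mem_states_iff.2 ⟨by rw [norm_smul, hc, hx, one_mul],
    by rw [norm_smul, norm_inv, hc, hf, inv_one, one_mul], ?_⟩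
  simp [hfx, hc0]

/-- Adding to `T` a small multiple of the rank one operator `f ⊗ x`, where `(x, f)` almost attains
the numerical radius of `T`, forces every state that almost attains the numerical radius of the
sum to be close to `(x, f)`, up to a scalar of modulus one. -/
theorem HasMicroTransitiveNorm.exists_perturbation [CompleteSpace X]
    (hX : HasMicroTransitiveNorm 𝕜 X) {ε : ℝ} (hε : 0 < ε) :
    ∃ η : ℝ, 0 < η ∧ η ≤ ε ∧ ∀ (T : X →L[𝕜] X) (x : X) (f : StrongDual 𝕜 X),
      (x, f) ∈ states 𝕜 X → numericalRadius T - η < ‖f (T x)‖ → ∀ η' : ℝ, 0 < η' →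
      ∃ (T' : X →L[𝕜] X) (x' : X) (f' : StrongDual 𝕜 X), (x', f') ∈ states 𝕜 X ∧
        numericalRadius T' - η' < ‖f' (T' x')‖ ∧ ‖T' - T‖ ≤ ε ∧ ‖x' - x‖ ≤ ε := by
  obtain ⟨δ, hδ, H⟩ := hX.exists_slice_subset_ball hε
  refine ⟨min (ε * δ / 2) ε, by positivity, min_le_right _ _, fun T x f hxf hT η' hη' => ?_⟩
  obtain ⟨hx, hf, hfx⟩ := mem_states_iff.1 hxf
  obtain ⟨c, hc, hcT⟩ : ∃ c : 𝕜, ‖c‖ = 1 ∧ f (T x) = ‖f (T x)‖ * c := by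
    obtain ⟨c, hc, h⟩ := RCLike.exists_norm_eq_mul_self (f (T x))
    have hc0 : c ≠ 0 := by rintro rfl; simp at hc
    exact ⟨c⁻¹, by rw [norm_inv, hc, inv_one], by rw [h]; field_simp⟩
  set R : X →L[𝕜] X := ((ε : 𝕜) * c) • f.smulRight x with hR
  have hRn : ‖R‖ ≤ ε := by
    rw [hR, norm_smul, norm_mul, hc, RCLike.norm_ofReal, abs_of_pos hε,
      ContinuousLinearMap.norm_smulRight_apply, hf, hx, mul_one, mul_one, mul_one]
  have hRapply : ∀ y, R y = ((ε : 𝕜) * c) • f y • x := fun y => rfl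
  have hval : ‖f ((T + R) x)‖ = ‖f (T x)‖ + ε := by
    have h1 : f ((T + R) x) = ((‖f (T x)‖ + ε : ℝ) : 𝕜) * c := by
      rw [add_apply, map_add, hRapply, hfx, one_smul, map_smul, hfx, smul_eq_mul, mul_one,
        RCLike.ofReal_add, add_mul, ← hcT]
    rw [h1, norm_mul, hc, mul_one, RCLike.norm_ofReal, abs_of_nonneg (by positivity)]
  have hv := norm_apply_le_numericalRadius (T + R) hxf
  rw [hval] at hv
  -- As `v(T + R)` exceeds `v(T)` by almost `ε`, a state `(y, g)` that almost attains it must have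
  -- `‖f y‖` almost `1`.
  obtain ⟨y, g, hyg, hy⟩ := exists_lt_norm_apply hxf (T + R)
    (r := numericalRadius (T + R) - min (min (ε * δ / 2) ε) η')
    (sub_lt_self _ (by positivity))
  obtain ⟨hy1, hg1, -⟩ := mem_states_iff.1 hyg
  have hup : ‖g ((T + R) y)‖ ≤ numericalRadius T + ε * ‖f y‖ := by
    rw [add_apply, map_add]
    refine (norm_add_le _ _).trans (add_le_add (norm_apply_le_numericalRadius T hyg) ?_)
    have hgx := g.unit_le_opNorm x hx.le
    rw [hg1] at hgx
    rw [hRapply, map_smul, map_smul, smul_eq_mul, smul_eq_mul, norm_mul, norm_mul, norm_mul, hc,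
      RCLike.norm_ofReal, abs_of_pos hε, mul_one]
    gcongr
    exact mul_le_of_le_one_right (norm_nonneg _) hgx
  have m1 := min_le_left (ε * δ / 2) ε
  have m2 := min_le_left (min (ε * δ / 2) ε) η'
  have m3 := min_le_right (min (ε * δ / 2) ε) η'
  have hfy : 1 - δ < ‖f y‖ := by
    refine lt_of_mul_lt_mul_left ?_ hε.le
    linarith
  obtain ⟨b, hb, hby⟩ := RCLike.exists_norm_eq_mul_self (f y)
  have hb0 : b ≠ 0 := by rintro rfl; simp at hb
  refine ⟨T + R, b • y, b⁻¹ • g, mem_states_smul hyg hb, ?_, by rwa [add_sub_cancel_left], ?_⟩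
  · rw [map_smul, map_smul, smul_apply, smul_smul, mul_inv_cancel₀ hb0, one_smul]
    linarith
  · rw [norm_sub_rev]
    refine (H x (b • y) f hxf (by rw [norm_smul, hb, hy1, one_mul]) ?_).le
    rwa [map_smul, smul_eq_mul, ← hby, RCLike.ofReal_re]

/-- The Bishop-Phelps-Bollobás property for the numerical radius: iterating the perturbation gives
convergent sequences of operators and of states, and the limit operator attains its numerical
radius at the limit state. -/
theorem HasMicroTransitiveNorm.exists_attaining [CompleteSpace X]
    (hX : HasMicroTransitiveNorm 𝕜 X) {ε : ℝ} (hε : 0 < ε) :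
    ∃ η : ℝ, 0 < η ∧ ∀ (T : X →L[𝕜] X) (x : X) (f : StrongDual 𝕜 X),
      (x, f) ∈ states 𝕜 X → numericalRadius T - η < ‖f (T x)‖ →
      ∃ (S : X →L[𝕜] X) (z : X) (k : StrongDual 𝕜 X), (z, k) ∈ states 𝕜 X ∧
        ‖k (S z)‖ = numericalRadius S ∧ ‖S - T‖ < ε ∧ ‖z - x‖ < ε := by
  have hεn : ∀ n : ℕ, 0 < ε / 2 / 2 / 2 ^ n := fun n => by positivity
  choose η hη hηε step using fun n : ℕ => hX.exists_perturbation (hεn n)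
  refine ⟨η 0, hη 0, fun T x f hxf hT => ?_⟩
  let P : ℕ → Type _ := fun n => {p : (X →L[𝕜] X) × X × StrongDual 𝕜 X //
    p.2 ∈ states 𝕜 X ∧ numericalRadius p.1 - η n < ‖p.2.2 (p.1 p.2.1)‖}
  have hstep : ∀ (n : ℕ) (p : P n), ∃ q : P (n + 1),
      ‖q.1.1 - p.1.1‖ ≤ ε / 2 / 2 / 2 ^ n ∧ ‖q.1.2.1 - p.1.2.1‖ ≤ ε / 2 / 2 / 2 ^ n := by
    rintro n ⟨⟨S, y, g⟩, hyg, hS⟩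
    obtain ⟨T', x', f', h1, h2, h3, h4⟩ := step n S y g hyg hS (η (n + 1)) (hη _)
    exact ⟨⟨(T', x', f'), h1, h2⟩, h3, h4⟩
  choose next hnext using hstep
  let s : ∀ n, P n := fun n => Nat.rec ⟨(T, x, f), hxf, hT⟩ next n
  have hs : ∀ n, s (n + 1) = next n (s n) := fun n => rfl
  have hTd : ∀ n, dist (s n).1.1 (s (n + 1)).1.1 ≤ ε / 2 / 2 / 2 ^ n := fun n => by
    rw [dist_comm, dist_eq_norm, hs]; exact (hnext n (s n)).1
  have hxd : ∀ n, dist (s n).1.2.1 (s (n + 1)).1.2.1 ≤ ε / 2 / 2 / 2 ^ n := fun n => by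
    rw [dist_comm, dist_eq_norm, hs]; exact (hnext n (s n)).2
  obtain ⟨S, hS⟩ := cauchySeq_tendsto_of_complete (cauchySeq_of_le_geometric_two hTd)
  obtain ⟨z, hz⟩ := cauchySeq_tendsto_of_complete (cauchySeq_of_le_geometric_two hxd)
  have hTS := dist_le_of_le_geometric_two_of_tendsto₀ hTd hS
  have hxz := dist_le_of_le_geometric_two_of_tendsto₀ hxd hz
  have hz1 : ‖z‖ = 1 := tendsto_nhds_unique hz.norm <| by
    simp_rw [fun n => (mem_states_iff.1 (s n).2.1).1]
    exact tendsto_const_nhds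
  obtain ⟨k, hk⟩ := exists_mem_states (𝕜 := 𝕜) hz1
  have hf : Filter.Tendsto (fun n => (s n).1.2.2) Filter.atTop (𝓝 k) := by
    refine Metric.tendsto_nhds.2 fun e he => ?_
    obtain ⟨δ, hδ, H⟩ := hX.hasUniformlyContinuousDuality e he
    filter_upwards [Metric.tendsto_nhds.1 hz δ hδ] with n hn
    rw [dist_eq_norm] at hn ⊢
    exact H _ _ _ _ (s n).2.1 hk hn
  have hval : Filter.Tendsto (fun n => ‖(s n).1.2.2 ((s n).1.1 (s n).1.2.1)‖) Filter.atTop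
      (𝓝 ‖k (S z)‖) := by
    have hSz := (isBoundedBilinearMap_apply.continuous.tendsto (S, z)).comp (hS.prodMk_nhds hz)
    exact ((isBoundedBilinearMap_apply.continuous.tendsto (k, S z)).comp
      (hf.prodMk_nhds hSz)).norm
  have hηlim : Filter.Tendsto η Filter.atTop (𝓝 0) := by
    refine squeeze_zero (fun n => (hη n).le) hηε ?_
    simpa [div_eq_mul_inv] using (tendsto_pow_atTop_nhds_zero_of_lt_one (r := (2 : ℝ)⁻¹)
      (by norm_num) (by norm_num)).const_mul (ε / 2 / 2)
  have hdist : Filter.Tendsto (fun n => ‖S - (s n).1.1‖) Filter.atTop (𝓝 0) := by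
    simpa using (hS.const_sub S).norm
  refine ⟨S, z, k, hk, le_antisymm (norm_apply_le_numericalRadius S hk) ?_, ?_, ?_⟩
  · have hle : ∀ n, numericalRadius S ≤
        ‖(s n).1.2.2 ((s n).1.1 (s n).1.2.1)‖ + η n + ‖S - (s n).1.1‖ := fun n => by
      have h1 := numericalRadius_le_add_norm_sub S (s n).1.1
      have h2 := (s n).2.2
      linarith
    have := ge_of_tendsto' ((hval.add hηlim).add hdist) hle
    simpa using this
  · rw [← dist_eq_norm, dist_comm]
    exact hTS.trans_lt (by linarith)
  · rw [← dist_eq_norm, dist_comm]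
    exact hxz.trans_lt (by linarith)

/-! ### Passing to the given state -/

/-- The quotient norm of `T` modulo the skew-hermitian operators is at most `1 / k` for some
`k > 0`; since the infimum need not be attained, the bound for a representative is larger by `1`. -/
theorem exists_mem_skewHermitian_norm_sub_le (h : 0 < secondNumericalIndex 𝕜 X) :
    ∃ M : ℝ, 0 < M ∧ ∀ T : X →L[𝕜] X, numericalRadius T = 1 →
      ∃ R ∈ skewHermitian 𝕜 X, ‖T - R‖ ≤ M := by
  have hne : {k : ℝ | 0 ≤ k ∧ ∀ T : X →L[𝕜] X,
      k * ‖(skewHermitian 𝕜 X).mkQ T‖ ≤ numericalRadius T}.Nonempty :=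
    ⟨0, le_rfl, fun T => by rw [zero_mul]; exact numericalRadius_nonneg T⟩
  obtain ⟨k, ⟨-, hk⟩, hk0⟩ := exists_lt_of_lt_csSup hne h
  refine ⟨1 / k + 1, by positivity, fun T hT => ?_⟩
  have h1 : ‖(skewHermitian 𝕜 X).mkQ T‖ < 1 / k + 1 := by
    have h2 := hk T
    rw [hT, mul_comm, ← le_div_iff₀ hk0] at h2
    linarith
  obtain ⟨S, hS, hSn⟩ := QuotientAddGroup.norm_lt_iff.1 h1
  refine ⟨T - S, ?_, by rw [sub_sub_cancel]; exact hSn.le⟩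
  exact (Submodule.Quotient.eq _).1 (Eq.symm hS)

/-- Conjugating by an isometry that moves `x` to `z` turns an operator attaining its numerical
radius at a state at `z` into one attaining it at the state at `x`. -/
theorem HasMicroTransitiveNorm.exists_attaining_at (hX : HasMicroTransitiveNorm 𝕜 X)
    {S : X →L[𝕜] X} {x z : X} {f k : StrongDual 𝕜 X} (hxf : (x, f) ∈ states 𝕜 X)
    (hzk : (z, k) ∈ states 𝕜 X) (hS : ‖k (S z)‖ = numericalRadius S) {g : X ≃ₗᵢ[𝕜] X}
    (hg : g x = z) : ∃ S' : X →L[𝕜] X, ‖f (S' x)‖ = numericalRadius S ∧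
      numericalRadius S' = numericalRadius S ∧
      ‖S' - S‖ ≤ 2 * ‖S‖ * ‖(g : X →L[𝕜] X) - .id 𝕜 X‖ := by
  set S' : X →L[𝕜] X := (g.symm : X →L[𝕜] X).comp (S.comp (g : X →L[𝕜] X)) with hS'
  have happly : ∀ y, S' y = g.symm (S (g y)) := fun y => rfl
  have hfS : ‖f (S' x)‖ = numericalRadius S := by
    subst hg
    rw [hX.eq_of_mem_states hxf (mem_states_comp g hzk), ← hS, happly]
    change ‖k (g (g.symm (S (g x))))‖ = _
    rw [g.apply_symm_apply]
  refine ⟨S', hfS, le_antisymm ?_ ?_, ?_⟩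
  · refine numericalRadius_le (numericalRadius_nonneg S) fun y q hyq => ?_
    have hq : (g y, q.comp (g.symm : X →L[𝕜] X)) ∈ states 𝕜 X :=
      mem_states_comp g.symm (by rwa [g.symm_apply_apply])
    exact norm_apply_le_numericalRadius S hq
  · rw [← hfS]
    exact norm_apply_le_numericalRadius S' hxf
  · refine ContinuousLinearMap.opNorm_le_bound _ (by positivity) fun y => ?_
    set D : X →L[𝕜] X := (g : X →L[𝕜] X) - .id 𝕜 X with hD
    have e : g ((S' - S) y) = S (D y) - D (S y) := by
      have h1 : D y = g y - y := rfl
      have h2 : D (S y) = g (S y) - S y := rfl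
      rw [sub_apply, map_sub, happly, g.apply_symm_apply, h1, h2, map_sub]
      abel
    rw [← g.norm_map, e]
    have h1 : ‖S (D y)‖ ≤ ‖S‖ * (‖D‖ * ‖y‖) :=
      (S.le_opNorm _).trans (by gcongr; exact D.le_opNorm _)
    have h2 : ‖D (S y)‖ ≤ ‖D‖ * (‖S‖ * ‖y‖) :=
      (D.le_opNorm _).trans (by gcongr; exact S.le_opNorm _)
    refine (norm_sub_le _ _).trans ((add_le_add h1 h2).trans_eq ?_)
    ring

end Attaining

end NumRadius

theorem theorem2p1 (𝕜 : Type*) [RCLike 𝕜] (X : Type*) [NormedAddCommGroup X] [NormedSpace 𝕜 X]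
    [CompleteSpace X] (hmicro : NumRadius.HasMicroTransitiveNorm 𝕜 X)
    (hindex : 0 < NumRadius.secondNumericalIndex 𝕜 X) : NumRadius.HasBPBppNu 𝕜 X := by
  open NumRadius in
  intro ε hε
  obtain ⟨M, hM, hZ⟩ := exists_mem_skewHermitian_norm_sub_le hindex
  obtain ⟨δ, hδ, Hg⟩ := hmicro.exists_isometry_near_id (ε := ε / (16 * (M + 1))) (by positivity)
  set ε₁ := min δ (min (1 / 2) (ε / (8 * (M + 1)))) with hε₁
  have hε₁0 : 0 < ε₁ := by positivity
  have m1 : ε₁ ≤ δ := min_le_left _ _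
  have m2 : ε₁ ≤ 1 / 2 := (min_le_right _ _).trans (min_le_left _ _)
  have m3 : ε₁ ≤ ε / (8 * (M + 1)) := (min_le_right _ _).trans (min_le_right _ _)
  obtain ⟨η, hη, H⟩ := hmicro.exists_attaining hε₁0
  refine ⟨η, hη, fun T hT x f hxf hfT => ?_⟩
  obtain ⟨R, hR, hTR⟩ := hZ T hT
  have hR0 := (numericalRadius_eq_zero_iff R).1 hR
  -- Modulo `R`, which vanishes at all states, `T` becomes the operator `T - R` of norm at most `M`.
  have hvR : ∀ S : X →L[𝕜] X, ∀ p ∈ states 𝕜 X, p.2 ((S + R) p.1) = p.2 (S p.1) :=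
    fun S p hp => by rw [add_apply, map_add, hR0 p hp, add_zero]
  have hvT : ∀ p ∈ states 𝕜 X, p.2 ((T - R) p.1) = p.2 (T p.1) := fun p hp => by
    rw [sub_apply, map_sub, hR0 p hp, sub_zero]
  have hT1 : numericalRadius (T - R) ≤ 1 := numericalRadius_le zero_le_one fun y q hyq => by
    rw [hvT _ hyq, ← hT]; exact norm_apply_le_numericalRadius T hyq
  have hT1' : 1 ≤ numericalRadius (T - R) := by
    rw [← hT]
    refine numericalRadius_le (numericalRadius_nonneg _) fun y q hyq => ?_
    rw [← hvT _ hyq]; exact norm_apply_le_numericalRadius (T - R) hyq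
  obtain ⟨S, z, k, hzk, hS, hST, hzx⟩ := H (T - R) x f hxf (by rw [hvT _ hxf]; linarith)
  obtain ⟨hx, -, -⟩ := mem_states_iff.1 hxf
  obtain ⟨hz, -, -⟩ := mem_states_iff.1 hzk
  obtain ⟨g, hg, hgn⟩ := Hg x z hx hz (by rw [norm_sub_rev]; linarith)
  obtain ⟨S', hfS', hvS', hS'S⟩ := hmicro.exists_attaining_at hxf hzk hS hg
  have v1 := numericalRadius_le_add_norm_sub S (T - R)
  have v2 := numericalRadius_le_add_norm_sub (T - R) S
  rw [norm_sub_rev] at v2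
  set v := numericalRadius S with hv
  have hv0 : 0 < v := by linarith
  have hSn : ‖S‖ ≤ M + 1 := by
    have := norm_le_norm_sub_add S (T - R)
    linarith
  -- Renormalize the conjugate `S'` to numerical radius `1`, and add `R` back.
  have hval : ‖f (((((v⁻¹ : ℝ) : 𝕜) • S') + R) x)‖ = 1 := by
    rw [hvR _ _ hxf, smul_apply, map_smul, norm_smul, hfS', RCLike.norm_ofReal,
      abs_of_pos (inv_pos.2 hv0), inv_mul_cancel₀ hv0.ne']
  refine ⟨((v⁻¹ : ℝ) : 𝕜) • S' + R, le_antisymm ?_ ?_, hval, ?_⟩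
  · refine numericalRadius_le zero_le_one fun y q hyq => ?_
    rw [hvR _ _ hyq, smul_apply, map_smul, norm_smul, RCLike.norm_ofReal,
      abs_of_pos (inv_pos.2 hv0), inv_mul_le_one₀ hv0, ← hvS']
    exact norm_apply_le_numericalRadius S' hyq
  · rw [← hval]
    exact norm_apply_le_numericalRadius _ hxf
  · have e : ((v⁻¹ : ℝ) : 𝕜) • S' + R - T
        = ((v⁻¹ : ℝ) : 𝕜) • (S' - S) + ((v⁻¹ - 1 : ℝ) : 𝕜) • S + (S - (T - R)) := by
      rw [RCLike.ofReal_sub, sub_smul, smul_sub, RCLike.ofReal_one, one_smul]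
      abel
    have hvi : v⁻¹ ≤ 2 := by
      rw [inv_le_comm₀ hv0 two_pos]; linarith
    have hvi' : |v⁻¹ - 1| ≤ 2 * ε₁ := by
      have h1 : v⁻¹ - 1 = v⁻¹ * (1 - v) := by rw [mul_sub, inv_mul_cancel₀ hv0.ne', mul_one]
      rw [h1, abs_mul, abs_of_pos (inv_pos.2 hv0)]
      gcongr
      rw [abs_le]; constructor <;> linarith
    have n1 : ‖((v⁻¹ : ℝ) : 𝕜) • (S' - S)‖ ≤ ε / 4 := by
      rw [norm_smul, RCLike.norm_ofReal, abs_of_pos (inv_pos.2 hv0)]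
      calc _ ≤ 2 * (2 * (M + 1) * (ε / (16 * (M + 1)))) := by
            gcongr
            exact hS'S.trans (by gcongr)
        _ = ε / 4 := by field_simp; norm_num
    have n2 : ‖((v⁻¹ - 1 : ℝ) : 𝕜) • S‖ ≤ ε / 4 := by
      rw [norm_smul, RCLike.norm_ofReal]
      calc _ ≤ 2 * (ε / (8 * (M + 1))) * (M + 1) := by gcongr; linarith
        _ = ε / 4 := by field_simp; norm_num
    have n3 : ε₁ ≤ ε / 8 := m3.trans (by gcongr; linarith)
    rw [e]
    refine (norm_add₃_le).trans_lt ?_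
    linarith
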